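/- Let $\operatorname{Homeo}^+(\mathbb{R})$ be the group of orientation-preserving homeomorphisms of $\mathbb{R}$ under composition, and let Thompson's group be its subgroup $F=\langle a,b\rangle$ generated by \[ a(x)=x+1,\qquad b(x)=\begin{cases} x & \text{if } x\le 0,\\ 2x & \text{if } 0<x<1,\\ x+1 & \text{if } 1\le x.\end{cases} \] Let $I=[0,1]$ and let $\operatorname{Diff}^\infty(I)$ be the group, under composition, of orientation-preserving $C^\infty$ diffeomorphisms of $I$ ($C^\infty$ up to and including the endpoints, with $C^\infty$ inverse). Then $F$ can be realized as a subgroup of $\operatorname{Diff}^\infty(I)$; that is, there exists an injective group homomorphism $F\to\operatorname{Diff}^\infty(I)$. -/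

import Mathlib

open scoped Manifold ContDiff

namespace ThompsonSmooth

/-- The translation `x ↦ x + 1` of the real line. -/
noncomputable def translation : ℝ ≃ₜ ℝ := Homeomorph.addRight 1

/-- The map equal to `x` for `x ≤ 0`, to `2x` for `0 < x < 1` and to `x + 1` for `1 ≤ x`. -/
noncomputable def stepFun (x : ℝ) : ℝ :=
  if x ≤ 0 then x else if x < 1 then 2 * x else x + 1

/-- The inverse of `stepFun`. -/
noncomputable def stepInv (y : ℝ) : ℝ :=
  if y ≤ 0 then y else if y < 2 then y / 2 else y - 1

theorem stepInv_stepFun (x : ℝ) : stepInv (stepFun x) = x := by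
  unfold stepFun stepInv
  split_ifs <;> linarith

theorem stepFun_stepInv (y : ℝ) : stepFun (stepInv y) = y := by
  unfold stepFun stepInv
  split_ifs <;> linarith

theorem stepFun_strictMono : StrictMono stepFun := by
  intro x y h
  unfold stepFun
  split_ifs <;> linarith

theorem stepInv_strictMono : StrictMono stepInv := by
  intro x y h
  unfold stepInv
  split_ifs <;> linarith

/-- The piecewise linear homeomorphism `stepFun` of the real line. -/
noncomputable def step : ℝ ≃ₜ ℝ where
  toFun := stepFun
  invFun := stepInv
  left_inv := stepInv_stepFun
  right_inv := stepFun_stepInv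
  continuous_toFun := stepFun_strictMono.monotone.continuous_of_surjective
    fun y => ⟨stepInv y, stepFun_stepInv y⟩
  continuous_invFun := stepInv_strictMono.monotone.continuous_of_surjective
    fun x => ⟨stepFun x, stepInv_stepFun x⟩

/-- Orientation-preserving homeomorphisms of the real line, under composition. -/
def HomeoPlus : Subgroup (ℝ ≃ₜ ℝ) where
  carrier := {f | StrictMono f}
  mul_mem' := fun {_ _} hf hg => hf.comp hg
  one_mem' := strictMono_id
  inv_mem' := fun {f} hf x y h => by
    have h' : f (f.symm x) < f (f.symm y) := by simpa using h
    exact hf.lt_iff_lt.1 h'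

/-- The standard copy of Thompson's group `F`: the group of orientation-preserving homeomorphisms
of the real line generated by `translation` and `step`. -/
noncomputable def ThompsonF : Subgroup HomeoPlus :=
  Subgroup.closure
    {⟨translation, fun _ _ h => add_lt_add_left h 1⟩, ⟨step, stepFun_strictMono⟩}

/-- Mathlib's `C^∞` diffeomorphisms of the closed interval `[0,1]`, a one-dimensional manifold with
boundary, form a group under composition. -/
noncomputable instance diffGroup : Group (Diffeomorph (𝓡∂ 1) (𝓡∂ 1) unitInterval unitInterval ∞) where
  mul f g := g.trans f
  one := Diffeomorph.refl (𝓡∂ 1) unitInterval ∞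
  inv f := f.symm
  mul_assoc _ _ _ := rfl
  one_mul _ := rfl
  mul_one _ := rfl
  inv_mul_cancel f := Diffeomorph.ext fun x => f.symm_apply_apply x

/-- `Diff^∞(I)`: the group of orientation-preserving `C^∞` diffeomorphisms of `I = [0,1]`. -/
def DiffPlus : Subgroup (Diffeomorph (𝓡∂ 1) (𝓡∂ 1) unitInterval unitInterval ∞) where
  carrier := {f | StrictMono f}
  mul_mem' := fun {_ _} hf hg => hf.comp hg
  one_mem' := strictMono_id
  inv_mem' := fun {f} hf x y h => by
    have h' : f (f.symm x) < f (f.symm y) := by simpa using h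
    exact hf.lt_iff_lt.1 h'

end ThompsonSmooth

namespace ThompsonSmooth

/-! ### Fractions and sorted words from the shift relations. -/

section ShiftRelations

variable {G : Type*} [Group G]

/-! The argument is ping-pong-like and needs no finite presentation of `F`. From two maps `a`, `b`
form `a⁻¹` and the conjugates of `b⁻¹` by powers of `a`. If they move points as in `ThompsonPair`,
this sequence satisfies the shift relations, so every element of the generated group is `p * q⁻¹`
with `p`, `q` words of nondecreasing index; and `ThompsonPair.sorted_prod_injective` shows that
distinct such words act differently.

Now take such a pair in `Homeo⁺(ℝ)` and another in `Diff^∞(I)`. The subgroup of the product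
generated by the paired generators obeys the same relations, so by
`ShiftRelations.eq_one_of_map_eq_one` both projections are injective on it: it is the graph of the
desired embedding. A smooth pair comes from a bump displacement and its cutoff. -/

/-- The relations `z j * z i = z i * z (j + 1)` for `i < j` of the infinite presentation of
Thompson's group. -/
def ShiftRelations (z : ℕ → G) : Prop :=
  ∀ i j, i < j → z j * z i = z i * z (j + 1)

/-- Positive words absorb an inverse generator on the left, leaving a fraction. -/
theorem ShiftRelations.inv_mul_eq_fraction {z : ℕ → G} (hz : ShiftRelations z) {p : G}
    (hp : p ∈ Submonoid.closure (Set.range z)) (i : ℕ) :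
    ∃ p' ∈ Submonoid.closure (Set.range z), ∃ q ∈ Submonoid.closure (Set.range z),
      (z i)⁻¹ * p = p' * q⁻¹ := by
  induction hp using Submonoid.closure_induction_left generalizing i with
  | one => exact ⟨1, one_mem _, z i, Submonoid.subset_closure ⟨i, rfl⟩, by simp⟩
  | mul_left x hx y hy ih =>
    obtain ⟨k, rfl⟩ := hx
    -- Moving `(z i)⁻¹` past `z k` raises the larger index by one, so the induction must allow every
    -- `i`.
    rcases lt_trichotomy i k with h | rfl | h
    · obtain ⟨p', hp', q, hq, e⟩ := ih i
      refine ⟨z (k + 1) * p', mul_mem (Submonoid.subset_closure ⟨_, rfl⟩) hp', q, hq, ?_⟩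
      have h1 : (z i)⁻¹ * z k = z (k + 1) * (z i)⁻¹ := by
        rw [inv_mul_eq_iff_eq_mul, ← mul_assoc, ← hz i k h, mul_inv_cancel_right]
      rw [← mul_assoc, h1, mul_assoc, e, mul_assoc]
    · exact ⟨y, hy, 1, one_mem _, by simp⟩
    · obtain ⟨p', hp', q, hq, e⟩ := ih (i + 1)
      refine ⟨z k * p', mul_mem (Submonoid.subset_closure ⟨_, rfl⟩) hp', q, hq, ?_⟩
      have h1 : (z i)⁻¹ * z k = z k * (z (i + 1))⁻¹ := by
        rw [inv_mul_eq_iff_eq_mul, ← mul_assoc, hz k i h, mul_inv_cancel_right]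
      rw [← mul_assoc, h1, mul_assoc, e, mul_assoc]

/-- Every element of the group generated by the `z i` is a fraction of positive words. -/
theorem ShiftRelations.eq_fraction {z : ℕ → G} (hz : ShiftRelations z) {g : G}
    (hg : g ∈ Subgroup.closure (Set.range z)) :
    ∃ p ∈ Submonoid.closure (Set.range z), ∃ q ∈ Submonoid.closure (Set.range z),
      g = p * q⁻¹ := by
  induction hg using Subgroup.closure_induction_left with
  | one => exact ⟨1, one_mem _, 1, one_mem _, by simp⟩
  | mul_left x hx y hy ih =>
    obtain ⟨p, hp, q, hq, rfl⟩ := ih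
    exact ⟨x * p, mul_mem (Submonoid.subset_closure hx) hp, q, hq, (mul_assoc _ _ _).symm⟩
  | inv_mul_cancel x hx y hy ih =>
    obtain ⟨p, hp, q, hq, rfl⟩ := ih
    obtain ⟨i, rfl⟩ := hx
    obtain ⟨p', hp', q', hq', e⟩ := hz.inv_mul_eq_fraction hp i
    exact ⟨p', hp', q * q', mul_mem hq hq', by rw [← mul_assoc, e, mul_inv_rev, mul_assoc]⟩

/-- Insertion sort in which a letter gains one each time it passes a smaller one. The lower-bound
clause lets the smaller letter stay in front during the induction. -/
theorem ShiftRelations.exists_sorted_cons {z : ℕ → G} (hz : ShiftRelations z) (l : List ℕ)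
    (hl : l.Pairwise (· ≤ ·)) (i : ℕ) :
    ∃ l' : List ℕ, l'.Pairwise (· ≤ ·) ∧ (l'.map z).prod = z i * (l.map z).prod ∧
      ∀ b ≤ i, (∀ k ∈ l, b ≤ k) → ∀ k ∈ l', b ≤ k := by
  induction l generalizing i with
  | nil => exact ⟨[i], by simp, by simp, by simp⟩
  | cons k l ih =>
    rw [List.pairwise_cons] at hl
    rcases le_or_gt i k with h | h
    · refine ⟨i :: k :: l, ?_, by simp, ?_⟩
      · refine List.pairwise_cons.2 ⟨?_, List.pairwise_cons.2 hl⟩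
        simpa [h] using fun a ha => h.trans (hl.1 a ha)
      · intro b hb hk
        simpa [hb] using hk
    · obtain ⟨l', hl', e, hb'⟩ := ih hl.2 (i + 1)
      refine ⟨k :: l', List.pairwise_cons.2 ⟨hb' k (by omega) hl.1, hl'⟩, ?_, ?_⟩
      · simp [e, ← mul_assoc, hz k i h]
      · intro b hb hk
        simp only [List.mem_cons, forall_eq_or_imp] at hk ⊢
        exact ⟨hk.1, hb' b (by omega) hk.2⟩

/-- Every positive word can be rewritten as a word with nondecreasing indices. -/
theorem ShiftRelations.exists_sorted {z : ℕ → G} (hz : ShiftRelations z) {p : G}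
    (hp : p ∈ Submonoid.closure (Set.range z)) :
    ∃ l : List ℕ, l.Pairwise (· ≤ ·) ∧ (l.map z).prod = p := by
  induction hp using Submonoid.closure_induction_left with
  | one => exact ⟨[], by simp, by simp⟩
  | mul_left x hx y hy ih =>
    obtain ⟨i, rfl⟩ := hx
    obtain ⟨l, hl, rfl⟩ := ih
    obtain ⟨l', hl', e, -⟩ := hz.exists_sorted_cons l hl i
    exact ⟨l', hl', e⟩

/-- If words with nondecreasing indices are distinguished by a homomorphism, then the homomorphism
is injective on the group generated by the `z i`. -/
theorem ShiftRelations.eq_one_of_map_eq_one {H : Type*} [Group H] {z : ℕ → G}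
    (hz : ShiftRelations z) (f : G →* H)
    (hf : ∀ l l' : List ℕ, l.Pairwise (· ≤ ·) → l'.Pairwise (· ≤ ·) →
      (l.map (f ∘ z)).prod = (l'.map (f ∘ z)).prod → l = l')
    {g : G} (hg : g ∈ Subgroup.closure (Set.range z)) (h : f g = 1) : g = 1 := by
  obtain ⟨p, hp, q, hq, rfl⟩ := hz.eq_fraction hg
  obtain ⟨l, hl, rfl⟩ := hz.exists_sorted hp
  obtain ⟨l', hl', rfl⟩ := hz.exists_sorted hq
  rw [map_mul, map_inv, mul_inv_eq_one, map_list_prod, map_list_prod, List.map_map,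
    List.map_map] at h
  rw [hf l l' hl hl' h, mul_inv_cancel]

end ShiftRelations

section Order

variable {α : Type*} [LinearOrder α]

theorem prod_apply_le {z : ℕ → α ≃o α} (hle : ∀ i x, z i x ≤ x) (l : List ℕ) (x : α) :
    (l.map z).prod x ≤ x := by
  induction l with
  | nil => simp
  | cons i l ih =>
    rw [List.map_cons, List.prod_cons, RelIso.mul_apply]
    exact (hle i _).trans ih

theorem prod_apply_eq {z : ℕ → α ≃o α} {x : α} (l : List ℕ) (h : ∀ i ∈ l, z i x = x) :
    (l.map z).prod x = x := by
  induction l with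
  | nil => simp
  | cons i l ih =>
    rw [List.map_cons, List.prod_cons, RelIso.mul_apply, ih fun k hk => h k (by simp [hk]),
      h i (by simp)]

/-- Words with nondecreasing indices in order automorphisms moving points to the left are pairwise
distinct, provided that `z i` moves a point `t i` that all later ones fix. -/
theorem sorted_prod_injective {z : ℕ → α ≃o α} {t : ℕ → α} (hle : ∀ i x, z i x ≤ x)
    (hfix : ∀ i j, i < j → z j (t i) = t i) (hlt : ∀ i, z i (t i) < t i)
    (l l' : List ℕ) (hl : l.Pairwise (· ≤ ·)) (hl' : l'.Pairwise (· ≤ ·))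
    (h : (l.map z).prod = (l'.map z).prod) : l = l' := by
  -- The point `t i` separates the two words: the one starting with `i` moves it strictly left, the
  -- other fixes it. Equal first letters are cancelled below.
  have key : ∀ (i : ℕ) (l l' : List ℕ), (∀ k ∈ l', i < k) →
      ((i :: l).map z).prod ≠ (l'.map z).prod := by
    intro i l l' hk e
    have h1 : ((i :: l).map z).prod (t i) = (l'.map z).prod (t i) := by rw [e]
    rw [prod_apply_eq l' fun k hk' => hfix i k (hk k hk'), List.map_cons, List.prod_cons,
      RelIso.mul_apply] at h1
    exact absurd h1 (((z i).monotone (prod_apply_le hle l (t i))).trans_lt (hlt i)).ne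
  induction l generalizing l' with
  | nil =>
    cases l' with
    | nil => rfl
    | cons j l' => exact absurd h.symm (key j l' [] (by simp))
  | cons i l ih =>
    cases l' with
    | nil => exact absurd h (key i l [] (by simp))
    | cons j l' =>
      have hl₁ := List.pairwise_cons.1 hl
      have hl₂ := List.pairwise_cons.1 hl'
      rcases lt_trichotomy i j with hij | rfl | hij
      · refine absurd h (key i l _ ?_)
        simpa [hij] using fun k hk => hij.trans_le (hl₂.1 k hk)
      · rw [ih l' hl₁.2 hl₂.2 (by simpa using h)]
      · refine absurd h.symm (key j l' _ ?_)
        simpa [hij] using fun k hk => hij.trans_le (hl₁.1 k hk)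

/-- The dynamical configuration of the standard generators of Thompson's group: both maps move
points to the right, `b` is the identity up to `t` and coincides with `a` from `a t` on. -/
structure ThompsonPair (a b : α ≃o α) (t : α) : Prop where
  le_left : ∀ x, x ≤ a x
  le_right : ∀ x, x ≤ b x
  lt_left : t < a t
  right_eq_self : ∀ x ≤ t, b x = x
  right_eq_left : ∀ x, a t ≤ x → b x = a x

end Order

/-! ### From two generators to the infinite family. -/

/-- The generators of the infinite presentation of Thompson's group, in terms of two. -/
def shiftSeq {G : Type*} [Group G] (a b : G) : ℕ → G
  | 0 => a⁻¹
  | n + 1 => a ^ n * b⁻¹ * (a ^ n)⁻¹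

theorem map_shiftSeq {G H : Type*} [Group G] [Group H] (f : G →* H) (a b : G) (n : ℕ) :
    f (shiftSeq a b n) = shiftSeq (f a) (f b) n := by
  cases n <;> simp [shiftSeq]

theorem closure_range_shiftSeq {G : Type*} [Group G] (a b : G) :
    Subgroup.closure (Set.range (shiftSeq a b)) = Subgroup.closure {a, b} := by
  apply le_antisymm
  · rw [Subgroup.closure_le]
    rintro _ ⟨n, rfl⟩
    have ha : a ∈ Subgroup.closure {a, b} := Subgroup.subset_closure (by simp)
    have hb : b ∈ Subgroup.closure {a, b} := Subgroup.subset_closure (by simp)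
    cases n with
    | zero => exact inv_mem ha
    | succ n => exact mul_mem (mul_mem (pow_mem ha n) (inv_mem hb)) (inv_mem (pow_mem ha n))
  · rw [Subgroup.closure_le]
    rintro x (rfl | rfl)
    · have h := Subgroup.subset_closure (k := Set.range (shiftSeq x b)) ⟨0, rfl⟩
      simpa [shiftSeq] using h
    · have h := Subgroup.subset_closure (k := Set.range (shiftSeq a x)) ⟨1, rfl⟩
      simpa [shiftSeq] using h

/-- The shift relations for `shiftSeq` follow from those between `b` and the conjugates of `b`. -/
theorem shiftRelations_shiftSeq {G : Type*} [Group G] {a b : G}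
    (h : ∀ d : ℕ, b * (a ^ (d + 1) * b * (a ^ (d + 1))⁻¹) =
      a * (a ^ (d + 1) * b * (a ^ (d + 1))⁻¹) * a⁻¹ * b) :
    ShiftRelations (shiftSeq a b) := by
  intro i j hij
  obtain ⟨m, rfl⟩ : ∃ m, j = m + 1 := ⟨j - 1, by omega⟩
  cases i with
  | zero => simp only [shiftSeq, pow_succ']; group
  | succ n =>
    obtain ⟨d, rfl⟩ : ∃ d, m = n + (d + 1) := ⟨m - n - 1, by omega⟩
    -- The general relation is the inverse of the hypothesis, conjugated by `a ^ n`.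
    have h' := congrArg (fun g => a ^ n * g⁻¹ * (a ^ n)⁻¹) (h d)
    simp only [mul_inv_rev, inv_inv] at h'
    simp only [shiftSeq]
    have e : a ^ (n + (d + 1) + 1) = a ^ n * a * a ^ (d + 1) := by
      rw [← pow_succ, ← pow_add]; congr 1; omega
    rw [e, pow_add a n (d + 1)]
    simp only [mul_inv_rev, mul_assoc, inv_mul_cancel_left] at h' ⊢
    exact h'

section Order

variable {α : Type*} [LinearOrder α] {a b : α ≃o α} {t : α}

theorem ThompsonPair.le_pow_apply (h : ThompsonPair a b t) (n : ℕ) (x : α) : x ≤ (a ^ n) x := by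
  induction n with
  | zero => simp
  | succ n ih =>
    rw [pow_succ', RelIso.mul_apply]
    exact ih.trans (h.le_left _)

theorem ThompsonPair.conj_apply_eq (h : ThompsonPair a b t) (n : ℕ) {x : α}
    (hx : x ≤ (a ^ n) t) : (a ^ n * b * (a ^ n)⁻¹) x = x := by
  have h1 : (a ^ n)⁻¹ x ≤ t := by
    rw [← (a ^ n).le_iff_le, RelIso.apply_inv_self]; exact hx
  rw [RelIso.mul_apply, RelIso.mul_apply, h.right_eq_self _ h1, RelIso.apply_inv_self]

theorem ThompsonPair.le_conj_apply (h : ThompsonPair a b t) (n : ℕ) (x : α) :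
    x ≤ (a ^ n * b * (a ^ n)⁻¹) x := by
  have h1 := (a ^ n).monotone (h.le_right ((a ^ n)⁻¹ x))
  rwa [RelIso.apply_inv_self] at h1

/-- The relation says that `a⁻¹ * b` commutes with a conjugate `c` of `b`. Their supports are
disjoint: `a⁻¹ * b` is trivial from `a t` on, and `c` is trivial up to `a t`. -/
theorem ThompsonPair.shiftRelations (h : ThompsonPair a b t) :
    ShiftRelations (shiftSeq a b) := by
  refine shiftRelations_shiftSeq fun d => ?_
  ext x
  have hle := h.le_conj_apply (d + 1)
  have hfix := @ThompsonPair.conj_apply_eq _ _ _ _ _ h (d + 1)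
  generalize a ^ (d + 1) * b * (a ^ (d + 1))⁻¹ = c at hle hfix ⊢
  have hat : a t ≤ (a ^ (d + 1)) t := by
    rw [pow_succ', RelIso.mul_apply]; exact a.monotone (h.le_pow_apply d t)
  simp only [RelIso.mul_apply]
  rcases le_total (a t) x with hx | hx
  · rw [h.right_eq_left _ (hx.trans (hle x)), h.right_eq_left x hx, RelIso.inv_apply_self]
  · have h1 : a⁻¹ (b x) ≤ a t := by
      rw [← a.le_iff_le, RelIso.apply_inv_self, ← h.right_eq_left _ le_rfl]
      exact b.monotone hx
    rw [hfix (hx.trans hat), hfix (h1.trans hat), RelIso.apply_inv_self]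

theorem ThompsonPair.sorted_prod_injective (h : ThompsonPair a b t) (l l' : List ℕ)
    (hl : l.Pairwise (· ≤ ·)) (hl' : l'.Pairwise (· ≤ ·))
    (e : (l.map (shiftSeq a b)).prod = (l'.map (shiftSeq a b)).prod) : l = l' := by
  have hsucc : ∀ n, shiftSeq a b (n + 1) = (a ^ n * b * (a ^ n)⁻¹)⁻¹ := fun n => by
    simp [shiftSeq, mul_assoc]
  have hinv : ∀ (c : α ≃o α), (∀ x, x ≤ c x) → ∀ x, c⁻¹ x ≤ x := fun c hc x => by
    rw [← c.le_iff_le, RelIso.apply_inv_self]; exact hc x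
  -- The conjugate of `b` by `a ^ n` fixes everything up to `(a ^ n) t` but moves `(a ^ (n + 1)) t`.
  refine ThompsonSmooth.sorted_prod_injective (t := fun n => (a ^ n) t) ?_ ?_ ?_ l l' hl hl' e
  · intro i
    cases i with
    | zero => exact hinv a h.le_left
    | succ n => rw [hsucc]; exact hinv _ (h.le_conj_apply n)
  · intro i j hij
    obtain ⟨d, rfl⟩ : ∃ d, j = i + d + 1 := ⟨j - i - 1, by omega⟩
    have hx : (a ^ i) t ≤ (a ^ (i + d)) t := by
      rw [pow_add, RelIso.mul_apply]; exact (a ^ i).monotone (h.le_pow_apply d t)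
    rw [hsucc]
    apply (a ^ (i + d) * b * (a ^ (i + d))⁻¹).injective
    rw [RelIso.apply_inv_self, h.conj_apply_eq _ hx]
  · intro i
    cases i with
    | zero => simpa [shiftSeq, ← a.lt_iff_lt (x := a⁻¹ t)] using h.lt_left
    | succ n =>
      rw [hsucc, ← (a ^ n * b * (a ^ n)⁻¹).lt_iff_lt, RelIso.apply_inv_self]
      simp only [pow_succ, RelIso.mul_apply, RelIso.inv_apply_self]
      rw [h.right_eq_left _ le_rfl, OrderIso.lt_iff_lt, OrderIso.lt_iff_lt]
      exact h.lt_left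

end Order

/-! ### The embedding as a graph in the product. -/

/-- Groups generated by pairs acting faithfully in the configuration of Thompson's generators
embed into one another. -/
theorem exists_injective_of_thompsonPair {G H α β : Type*} [Group G] [Group H] [LinearOrder α]
    [LinearOrder β] (ρ : G →* (α ≃o α)) (hρ : Function.Injective ρ) (σ : H →* (β ≃o β))
    (hσ : Function.Injective σ) {a b : G} {c d : H} {s : α} {t : β}
    (h₁ : ThompsonPair (ρ a) (ρ b) s) (h₂ : ThompsonPair (σ c) (σ d) t) :
    ∃ φ : Subgroup.closure {a, b} →* H, Function.Injective φ := by
  let z : ℕ → G × H := shiftSeq (a, c) (b, d)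
  have hz1 : ∀ n, ρ (z n).1 = shiftSeq (ρ a) (ρ b) n := fun n =>
    map_shiftSeq (ρ.comp (MonoidHom.fst G H)) (a, c) (b, d) n
  have hz2 : ∀ n, σ (z n).2 = shiftSeq (σ c) (σ d) n := fun n =>
    map_shiftSeq (σ.comp (MonoidHom.snd G H)) (a, c) (b, d) n
  -- Faithfulness of both actions pulls the relations back to the product.
  have hz : ShiftRelations z := fun i j hij => Prod.ext
    (hρ (by simpa [hz1] using h₁.shiftRelations i j hij))
    (hσ (by simpa [hz2] using h₂.shiftRelations i j hij))
  let Γ := Subgroup.closure (Set.range z)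
  have hΓ : Γ = Subgroup.closure {(a, c), (b, d)} := closure_range_shiftSeq _ _
  have inj1 : Function.Injective ((MonoidHom.fst G H).comp Γ.subtype) := by
    refine (injective_iff_map_eq_one _).2 fun g hg => Subtype.ext ?_
    refine hz.eq_one_of_map_eq_one (ρ.comp (MonoidHom.fst G H)) ?_ g.2
      ((congrArg ρ hg).trans (map_one ρ))
    rw [show (ρ.comp (MonoidHom.fst G H)) ∘ z = shiftSeq (ρ a) (ρ b) from funext hz1]
    exact h₁.sorted_prod_injective
  have inj2 : Function.Injective ((MonoidHom.snd G H).comp Γ.subtype) := by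
    refine (injective_iff_map_eq_one _).2 fun g hg => Subtype.ext ?_
    refine hz.eq_one_of_map_eq_one (σ.comp (MonoidHom.snd G H)) ?_ g.2
      ((congrArg σ hg).trans (map_one σ))
    rw [show (σ.comp (MonoidHom.snd G H)) ∘ z = shiftSeq (σ c) (σ d) from funext hz2]
    exact h₂.sorted_prod_injective
  have hrange : Subgroup.closure {a, b} = ((MonoidHom.fst G H).comp Γ.subtype).range := by
    rw [MonoidHom.range_comp, Subgroup.range_subtype, hΓ, MonoidHom.map_closure, Set.image_pair]
    rfl
  exact ⟨((MonoidHom.snd G H).comp Γ.subtype).comp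
      ((MonoidHom.ofInjective inj1).symm.toMonoidHom.comp
        (Subgroup.inclusion hrange.le)),
    inj2.comp ((MonoidHom.ofInjective inj1).symm.injective.comp
      (Subgroup.inclusion_injective _))⟩

/-- The action of `HomeoPlus` on the line by order automorphisms. -/
def HomeoPlus.toOrderIso : HomeoPlus →* (ℝ ≃o ℝ) where
  toFun f := ⟨f.1.toEquiv, f.2.le_iff_le⟩
  map_one' := rfl
  map_mul' _ _ := rfl

theorem HomeoPlus.toOrderIso_injective : Function.Injective HomeoPlus.toOrderIso :=
  fun _ _ h => Subtype.ext (Homeomorph.ext fun x => DFunLike.congr_fun h x)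

/-- The action of `DiffPlus` on the interval by order automorphisms. -/
def DiffPlus.toOrderIso : DiffPlus →* (unitInterval ≃o unitInterval) where
  toFun f := ⟨f.1.toEquiv, f.2.le_iff_le⟩
  map_one' := rfl
  map_mul' _ _ := rfl

theorem DiffPlus.toOrderIso_injective : Function.Injective DiffPlus.toOrderIso :=
  fun _ _ h => Subtype.ext (Diffeomorph.ext fun x => DFunLike.congr_fun h x)

theorem thompsonPair_translation_step :
    ThompsonPair (HomeoPlus.toOrderIso ⟨translation, fun _ _ h => add_lt_add_left h 1⟩)
      (HomeoPlus.toOrderIso ⟨step, stepFun_strictMono⟩) 0 := by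
  have ha : ∀ x, HomeoPlus.toOrderIso ⟨translation, fun _ _ h => add_lt_add_left h 1⟩ x = x + 1 :=
    fun _ => rfl
  have hb : ∀ x, HomeoPlus.toOrderIso ⟨step, stepFun_strictMono⟩ x = stepFun x := fun _ => rfl
  constructor <;> simp only [ha, hb, stepFun] <;> intros <;> (try split_ifs) <;> linarith

/-! ### A smooth pair on the interval. -/

section Interval

/-- A smooth function with positive derivative at bounded distance from the identity is an order
automorphism of the line with smooth inverse. -/
theorem exists_orderIso_contDiff {f : ℝ → ℝ} (hf : ContDiff ℝ ∞ f) (hpos : ∀ x, 0 < deriv f x)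
    {C : ℝ} (hC : ∀ x, |f x - x| ≤ C) :
    ∃ e : ℝ ≃o ℝ, ⇑e = f ∧ ContDiff ℝ ∞ e.symm := by
  have hmono : StrictMono f := strictMono_of_deriv_pos hpos
  have hsurj : Function.Surjective f := by
    intro y
    have h1 := abs_le.1 (hC (y - C))
    have h2 := abs_le.1 (hC (y + C))
    have hC0 : 0 ≤ C := (abs_nonneg _).trans (hC 0)
    obtain ⟨x, -, hx⟩ := intermediate_value_Icc (by linarith : y - C ≤ y + C)
      hf.continuous.continuousOn (show y ∈ Set.Icc (f (y - C)) (f (y + C)) from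
        ⟨by linarith, by linarith⟩)
    exact ⟨x, hx⟩
  refine ⟨hmono.orderIsoOfSurjective f hsurj, rfl, ?_⟩
  exact (hmono.orderIsoOfSurjective f hsurj).toHomeomorph.contDiff_symm_deriv
    (fun x => (hpos x).ne') (fun x => (hf.differentiable (by simp) x).hasDerivAt) hf

theorem contMDiff_codRestrict_unitInterval {f : ℝ → ℝ} (hf : ContDiff ℝ ∞ f)
    (h : ∀ x : unitInterval, f x ∈ unitInterval) :
    ContMDiff (𝓡∂ 1) (𝓡∂ 1) ∞ (fun x : unitInterval => (⟨f x, h x⟩ : unitInterval)) := by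
  rw [contMDiff_iff_comp_subtypeVal_Icc]
  refine ⟨(hf.continuous.comp continuous_subtype_val).subtype_mk _, ?_⟩
  exact hf.contMDiff.comp contMDiff_subtypeVal_Icc

/-- A smooth function with positive derivative at bounded distance from the identity, fixing `0`
and `1`, restricts to an element of `DiffPlus`. -/
theorem exists_diffPlus {f : ℝ → ℝ} (hf : ContDiff ℝ ∞ f) (hpos : ∀ x, 0 < deriv f x)
    {C : ℝ} (hC : ∀ x, |f x - x| ≤ C) (h0 : f 0 = 0) (h1 : f 1 = 1) :
    ∃ g : DiffPlus, ∀ x : unitInterval, (DiffPlus.toOrderIso g x : ℝ) = f x := by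
  obtain ⟨e, rfl, he⟩ := exists_orderIso_contDiff hf hpos hC
  have h0' : e.symm 0 = 0 := by rw [OrderIso.symm_apply_eq, h0]
  have h1' : e.symm 1 = 1 := by rw [OrderIso.symm_apply_eq, h1]
  have hm : ∀ x : unitInterval, e x ∈ unitInterval := fun x =>
    ⟨h0.symm.trans_le (e.monotone x.2.1), (e.monotone x.2.2).trans_eq h1⟩
  have hm' : ∀ x : unitInterval, e.symm x ∈ unitInterval := fun x =>
    ⟨h0'.symm.trans_le (e.symm.monotone x.2.1), (e.symm.monotone x.2.2).trans_eq h1'⟩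
  exact ⟨⟨{ toFun := fun x => ⟨e x, hm x⟩
            invFun := fun x => ⟨e.symm x, hm' x⟩
            left_inv := fun x => Subtype.ext (e.symm_apply_apply x)
            right_inv := fun x => Subtype.ext (e.apply_symm_apply x)
            contMDiff_toFun := contMDiff_codRestrict_unitInterval hf hm
            contMDiff_invFun := contMDiff_codRestrict_unitInterval he hm' },
    fun _ _ h => e.strictMono h⟩, fun _ => rfl⟩

/-- The smooth displacement `sin² (π x) / 4` multiplied by a cutoff `χ` with values in `[0,1]`
defines a diffeomorphism of the interval. -/
theorem exists_diffPlus_of_cutoff {χ : ℝ → ℝ} (hχ : ContDiff ℝ ∞ χ) (hmono : Monotone χ)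
    (h0 : ∀ x, 0 ≤ χ x) (h1 : ∀ x, χ x ≤ 1) :
    ∃ g : DiffPlus, ∀ x : unitInterval,
      (DiffPlus.toOrderIso g x : ℝ) = x + χ x * (Real.sin (Real.pi * x) ^ 2 / 4) := by
  refine exists_diffPlus (f := fun x => x + χ x * (Real.sin (Real.pi * x) ^ 2 / 4)) (C := 1)
    (by fun_prop) (fun x => ?_) (fun x => ?_) (by simp) (by simp)
  · have hs : HasDerivAt (fun x => Real.sin (Real.pi * x) ^ 2 / 4)
        (Real.pi / 4 * (2 * Real.sin (Real.pi * x) * Real.cos (Real.pi * x))) x := by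
      have h := ((((hasDerivAt_id x).const_mul Real.pi).sin).pow 2).div_const 4
      convert! h using 1
      simp
      ring
    have hd := (hasDerivAt_id x).add ((hχ.differentiable (by simp) x).hasDerivAt.mul hs)
    have hd' : deriv (fun x => x + χ x * (Real.sin (Real.pi * x) ^ 2 / 4)) x = _ := hd.deriv
    rw [hd', ← Real.sin_two_mul]
    have hχ' : 0 ≤ deriv χ x := hmono.deriv_nonneg
    have hp : 0 ≤ deriv χ x * (Real.sin (Real.pi * x) ^ 2 / 4) := by positivity
    -- The only term that can make the derivative drop below `1`; the factor `1 / 4` in the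
    -- displacement controls it since `π < 4`.
    have hq : |χ x * (Real.pi / 4 * Real.sin (2 * (Real.pi * x)))| < 1 := by
      rw [abs_mul, abs_mul, abs_of_nonneg (h0 x), abs_of_pos (by positivity)]
      have hpi := Real.pi_lt_four
      calc χ x * (Real.pi / 4 * |Real.sin (2 * (Real.pi * x))|)
          ≤ 1 * (Real.pi / 4 * 1) := by
            gcongr
            · exact h1 x
            · exact Real.abs_sin_le_one _
        _ < 1 := by linarith
    linarith [neg_abs_le (χ x * (Real.pi / 4 * Real.sin (2 * (Real.pi * x))))]
  · have hs := Real.sin_sq_le_one (Real.pi * x)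
    have hn := sq_nonneg (Real.sin (Real.pi * x))
    rw [add_sub_cancel_left, abs_of_nonneg (mul_nonneg (h0 x) (by positivity))]
    calc χ x * (Real.sin (Real.pi * x) ^ 2 / 4) ≤ 1 * 1 := by
          gcongr
          · exact h1 x
          · linarith
      _ = 1 := one_mul 1

theorem exists_thompsonPair_diffPlus :
    ∃ (c d : DiffPlus) (t : unitInterval),
      ThompsonPair (DiffPlus.toOrderIso c) (DiffPlus.toOrderIso d) t := by
  obtain ⟨c, hc⟩ := exists_diffPlus_of_cutoff (χ := fun _ => 1) contDiff_const monotone_const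
    (fun _ => zero_le_one) (fun _ => le_rfl)
  -- The cutoff climbs from `0` to `1` exactly between `t = 1 / 2` and `c t = 3 / 4`.
  obtain ⟨d, hd⟩ := exists_diffPlus_of_cutoff (χ := fun x => Real.smoothTransition (4 * x - 2))
    (Real.smoothTransition.contDiff.comp (by fun_prop))
    (fun x y h => Real.smoothTransition.monotone (by linarith))
    (fun _ => Real.smoothTransition.nonneg _) (fun _ => Real.smoothTransition.le_one _)
  have hhalf : (DiffPlus.toOrderIso c ⟨1 / 2, by norm_num, by norm_num⟩ : ℝ) = 3 / 4 := by
    rw [hc]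
    simp only [mul_one_div, Real.sin_pi_div_two]
    norm_num
  refine ⟨c, d, ⟨1 / 2, by norm_num, by norm_num⟩, fun x => ?_, fun x => ?_, ?_, fun x hx => ?_,
    fun x hx => ?_⟩
  · rw [← Subtype.coe_le_coe, hc]
    linarith [sq_nonneg (Real.sin (Real.pi * x))]
  · rw [← Subtype.coe_le_coe, hd]
    have := Real.smoothTransition.nonneg (4 * x - 2)
    exact le_add_of_nonneg_right (by positivity)
  · rw [← Subtype.coe_lt_coe, hhalf]
    norm_num
  · have hx' : (x : ℝ) ≤ 1 / 2 := hx
    rw [← Subtype.coe_inj, hd, Real.smoothTransition.zero_of_nonpos (by linarith), zero_mul,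
      add_zero]
  · rw [← Subtype.coe_le_coe, hhalf] at hx
    rw [← Subtype.coe_inj, hd, hc, Real.smoothTransition.one_of_one_le (by linarith)]

end Interval

end ThompsonSmooth

theorem mainTheorem11 :
    ∃ φ : ThompsonSmooth.ThompsonF →* ThompsonSmooth.DiffPlus, Function.Injective φ := by
  obtain ⟨c, d, t, h⟩ := ThompsonSmooth.exists_thompsonPair_diffPlus
  exact ThompsonSmooth.exists_injective_of_thompsonPair ThompsonSmooth.HomeoPlus.toOrderIso
    ThompsonSmooth.HomeoPlus.toOrderIso_injective ThompsonSmooth.DiffPlus.toOrderIso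
    ThompsonSmooth.DiffPlus.toOrderIso_injective ThompsonSmooth.thompsonPair_translation_step h
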